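/- Theorem 4.7. Let $n \geq 1$. Every nonempty subset $A \subseteq \mathbb{Z}^n$ that is first-order definable (with parameters from $\mathbb{Z}$) in the structure $(\mathbb{Z},+,0)$ is a finite union of quasi-cosets in $\mathbb{Z}^n$. Here a coset of rank $k$ is a set $c+G$ with $c\in\mathbb{Z}^n$ and $G \leq \mathbb{Z}^n$ a subgroup that is free abelian of rank $k$. The rank $\mathrm{rk}(X)$ of a nonempty set $X\subseteq\mathbb{Z}^n$ is the least $k \in \{0,1,\dots,n\}$ such that $X$ is contained in a finite union of cosets in $\mathbb{Z}^n$ of rank at most $k$, and $\mathrm{rk}(\emptyset) = -1$. For $0\le k\le n$, a quasi-coset of rank $k$ is a set of the form $C\setminus Z$, where $C$ is a coset of rank $k$ and $Z\subseteq C$ is definable (with parameters) in $(\mathbb{Z},+,0)$ with $\mathrm{rk}(Z)<k$; a quasi-coset is a quasi-coset of rank $k$ for some $0\le k\le n$. -/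

import Mathlib

open FirstOrder

namespace QuasiCoset

/-- The function symbols of the language `{+, 0}`. -/
inductive AddFunc : ℕ → Type
  | zero : AddFunc 0
  | add : AddFunc 2

/-- The first-order language `{+, 0}` (equality is a logical symbol). -/
def addLang : Language where
  Functions := AddFunc
  Relations := fun _ => Empty

/-- The structure `(ℤ, +, 0)`. -/
instance intStructure : addLang.Structure ℤ where
  funMap {_} f v :=
    match f, v with
    | AddFunc.zero, _ => 0
    | AddFunc.add, v => v 0 + v 1
  RelMap {_} r _ := Empty.elim r

/-- `A ⊆ ℤⁿ` is definable in `(ℤ, +, 0)`, with parameters from `ℤ`. -/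
def IsDefinable {n : ℕ} (A : Set (Fin n → ℤ)) : Prop :=
  (Set.univ : Set ℤ).Definable addLang A

/-- `C` is a coset `c + G` of a subgroup `G ≤ ℤⁿ` of rank `k`. -/
def IsCosetOfRank {n : ℕ} (k : ℕ) (C : Set (Fin n → ℤ)) : Prop :=
  ∃ (c : Fin n → ℤ) (G : AddSubgroup (Fin n → ℤ)),
    Module.finrank ℤ G = k ∧ C = (fun g => c + g) '' (G : Set (Fin n → ℤ))

/-- `X` is contained in a finite union of cosets of rank at most `k`. -/
def CoveredInRank {n : ℕ} (k : ℕ) (X : Set (Fin n → ℤ)) : Prop :=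
  ∃ F : Set (Set (Fin n → ℤ)), F.Finite ∧
    (∀ C ∈ F, ∃ j ≤ k, IsCosetOfRank j C) ∧ X ⊆ ⋃₀ F

open Classical in
/-- The rank of `X ⊆ ℤⁿ`: `-1` if `X` is empty, and otherwise the least `k` such that `X` is
contained in a finite union of cosets of rank at most `k`. -/
noncomputable def rank {n : ℕ} (X : Set (Fin n → ℤ)) : ℤ :=
  if X = ∅ then -1 else ((sInf {k : ℕ | CoveredInRank k X} : ℕ) : ℤ)

/-- The minimum in the definition of the rank is over a nonempty set (it contains `n`). -/
theorem coveredInRank_self {n : ℕ} (X : Set (Fin n → ℤ)) : CoveredInRank n X := by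
  refine ⟨{Set.univ}, Set.finite_singleton _, ?_, by simp⟩
  rintro C rfl
  refine ⟨n, le_rfl, 0, ⊤, ?_, by simp⟩
  have h : Module.finrank ℤ (⊤ : Submodule ℤ (Fin n → ℤ)) = n := by
    rw [finrank_top, Module.finrank_fin_fun]
  exact h

/-- `X = C \ Z` where `C` is a coset of rank `k` and `Z ⊆ C` is definable of rank less than `k`. -/
def IsQuasiCosetOfRank {n : ℕ} (k : ℕ) (X : Set (Fin n → ℤ)) : Prop :=
  ∃ C Z : Set (Fin n → ℤ), IsCosetOfRank k C ∧ Z ⊆ C ∧ IsDefinable Z ∧ rank Z < (k : ℤ) ∧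
    X = C \ Z

/-- `X` is a quasi-coset of some rank `k`, where `0 ≤ k ≤ n`. -/
def IsQuasiCoset {n : ℕ} (X : Set (Fin n → ℤ)) : Prop :=
  ∃ k ≤ n, IsQuasiCosetOfRank k X

end QuasiCoset

namespace QuasiCoset

/-! The proof is a quantifier elimination followed by a rank argument. Terms are additive
homomorphisms, so atomic formulas cut out subgroups, and every definable set lies in the Boolean
algebra generated by cosets (`setOf_realize_mem_cosetAlgebra`), provided this algebra is stable
under projection along one coordinate (`image_fst_mem_cosetAlgebra`). Its members are finite unions
of differences `C \ Z` with `C` a coset and `Z` a finite union of cosets. Removing one coset from a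
quasi-coset leaves a finite union of quasi-cosets (`IsQuasiCoset.sdiff_coset`): the removed part
either has smaller rank and joins the exceptional set, or has finite index and its complement is
again made of cosets. -/

/-- `X` is the union of a finite family of sets satisfying `P`. -/
def FiniteUnion {α : Type*} (P : Set α → Prop) (X : Set α) : Prop :=
  ∃ F : Set (Set α), F.Finite ∧ (∀ Y ∈ F, P Y) ∧ X = ⋃₀ F

namespace FiniteUnion

variable {α : Type*} {P : Set α → Prop}

theorem empty : FiniteUnion P ∅ := ⟨∅, Set.finite_empty, by simp, by simp⟩

theorem of {X : Set α} (h : P X) : FiniteUnion P X :=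
  ⟨{X}, Set.finite_singleton _, by simpa using h, by simp⟩

theorem union {X Y : Set α} (hX : FiniteUnion P X) (hY : FiniteUnion P Y) :
    FiniteUnion P (X ∪ Y) := by
  obtain ⟨F, hF, hFP, rfl⟩ := hX
  obtain ⟨F', hF', hFP', rfl⟩ := hY
  exact ⟨F ∪ F', hF.union hF', by rintro Z (h | h); exacts [hFP Z h, hFP' Z h],
    Set.sUnion_union F F' |>.symm⟩

@[elab_as_elim]
theorem induction {p : ∀ X, FiniteUnion P X → Prop} (h_empty : p ∅ empty)
    (h_union : ∀ Y Z (hY : P Y) (hZ : FiniteUnion P Z), p Z hZ → p (Y ∪ Z) ((of hY).union hZ))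
    {X : Set α} (hX : FiniteUnion P X) : p X hX := by
  obtain ⟨F, hF, hFP, rfl⟩ := id hX
  induction F, hF using Set.Finite.induction_on with
  | empty => simpa using h_empty
  | @insert Y F _ hF ih =>
    have hFP' := fun Z hZ => hFP Z (Set.mem_insert_of_mem _ hZ)
    simpa [Set.sUnion_insert] using
      h_union Y _ (hFP Y (Set.mem_insert _ _)) ⟨F, hF, hFP', rfl⟩ (ih hFP' _)

theorem sUnion {F : Set (Set α)} (hF : F.Finite) (h : ∀ Y ∈ F, FiniteUnion P Y) :
    FiniteUnion P (⋃₀ F) := by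
  induction F, hF using Set.Finite.induction_on with
  | empty => simpa using empty
  | @insert Y F _ _ ih =>
    rw [Set.sUnion_insert]
    exact (h Y (Set.mem_insert _ _)).union (ih fun Z hZ => h Z (Set.mem_insert_of_mem _ hZ))

end FiniteUnion

/-! ### Boolean combinations of cosets, and their projections -/

section Cosets

variable {M N : Type*} [AddCommGroup M] [AddCommGroup N]

/-- `X` is a coset of some subgroup of `M`. -/
def IsCoset (X : Set M) : Prop :=
  ∃ (c : M) (G : AddSubgroup M), X = {x | x - c ∈ G}

theorem setOf_sub_mem_eq {G : AddSubgroup M} {c d : M} (h : d - c ∈ G) :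
    {x | x - c ∈ G} = {x | x - d ∈ G} := by
  ext x
  have : x - c = (x - d) + (d - c) := by abel
  simp only [Set.mem_ofPred_eq]
  rw [this, G.add_mem_cancel_right h]

theorem isCoset_univ : IsCoset (Set.univ : Set M) := ⟨0, ⊤, by simp⟩

/-- The preimage may be empty, and the empty set is not a coset; hence `FiniteUnion`. -/
theorem IsCoset.preimage {X : Set M} (hX : IsCoset X) (f : N →+ M) (b : M) :
    FiniteUnion IsCoset ((fun y => f y + b) ⁻¹' X) := by
  obtain ⟨c, G, rfl⟩ := hX
  by_cases h : ∃ d, f d + b - c ∈ G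
  · obtain ⟨d, hd⟩ := h
    refine .of ⟨d, G.comap f, ?_⟩
    ext y
    rw [setOf_sub_mem_eq hd]
    simp
  · convert FiniteUnion.empty
    ext y
    simpa using fun hy => h ⟨y, hy⟩

theorem IsCoset.inter {X Y : Set M} (hX : IsCoset X) (hY : IsCoset Y) :
    FiniteUnion IsCoset (X ∩ Y) := by
  obtain ⟨c, G, rfl⟩ := hX
  obtain ⟨d, H, rfl⟩ := hY
  by_cases h : ∃ e, e - c ∈ G ∧ e - d ∈ H
  · obtain ⟨e, h₁, h₂⟩ := h
    rw [setOf_sub_mem_eq h₁, setOf_sub_mem_eq h₂]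
    exact .of ⟨e, G ⊓ H, rfl⟩
  · convert FiniteUnion.empty
    ext y
    simpa using fun h₁ h₂ => h ⟨y, h₁, h₂⟩

theorem IsCoset.image {X : Set M} (hX : IsCoset X) (f : M →+ N) : IsCoset (f '' X) := by
  obtain ⟨c, G, rfl⟩ := hX
  refine ⟨f c, G.map f, ?_⟩
  ext y
  constructor
  · rintro ⟨x, hx, rfl⟩
    exact ⟨x - c, hx, by simp⟩
  · rintro ⟨g, hg, hgy⟩
    exact ⟨g + c, by simpa using hg, by simp [hgy]⟩

theorem FiniteUnion.isCoset_inter {X Y : Set M} (hX : FiniteUnion IsCoset X)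
    (hY : FiniteUnion IsCoset Y) : FiniteUnion IsCoset (X ∩ Y) := by
  induction hX using FiniteUnion.induction with
  | h_empty => simpa using .empty
  | h_union C Z hC _ ih =>
    rw [Set.union_inter_distrib_right]
    refine .union ?_ ih
    clear ih
    induction hY using FiniteUnion.induction with
    | h_empty => simpa using .empty
    | h_union D W hD _ ih =>
      rw [Set.inter_union_distrib_left]
      exact (hC.inter hD).union ih

theorem FiniteUnion.isCoset_preimage {X : Set M} (hX : FiniteUnion IsCoset X) (f : N →+ M)
    (b : M) : FiniteUnion IsCoset ((fun y => f y + b) ⁻¹' X) := by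
  induction hX using FiniteUnion.induction with
  | h_empty => simpa using .empty
  | h_union C Z hC _ ih => exact (hC.preimage f b).union ih

theorem FiniteUnion.isCoset_image {X : Set M} (hX : FiniteUnion IsCoset X) (f : M →+ N) :
    FiniteUnion IsCoset (f '' X) := by
  induction hX using FiniteUnion.induction with
  | h_empty => simpa using .empty
  | h_union C Z hC _ ih =>
    rw [Set.image_union]
    exact (FiniteUnion.of (hC.image f)).union ih

variable (M) in
/-- The Boolean algebra of subsets of `M` generated by the cosets of subgroups. -/
def cosetAlgebra : BooleanSubalgebra (Set M) :=
  BooleanSubalgebra.closure {X | FiniteUnion IsCoset X}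

theorem mem_cosetAlgebra {X : Set M} (hX : FiniteUnion IsCoset X) : X ∈ cosetAlgebra M :=
  BooleanSubalgebra.subset_closure hX

-- Finite unions of cosets are closed under union and intersection, so the algebra they generate
-- consists of finite unions of differences of two of them; the first term then splits into single
-- cosets.
@[elab_as_elim]
theorem cosetAlgebra_induction {p : ∀ X, X ∈ cosetAlgebra M → Prop}
    (h_empty : p ∅ BooleanSubalgebra.bot_mem)
    (h_union : ∀ X Y hX hY, p X hX → p Y hY → p (X ∪ Y) (BooleanSubalgebra.sup_mem hX hY))
    (h_sdiff : ∀ C Z (hC : IsCoset C) (hZ : FiniteUnion IsCoset Z), p (C \ Z)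
      (BooleanSubalgebra.sdiff_mem (mem_cosetAlgebra (.of hC)) (mem_cosetAlgebra hZ)))
    {X : Set M} (hX : X ∈ cosetAlgebra M) : p X hX := by
  refine BooleanSubalgebra.closure_sdiff_sup_induction (p := p)
    ⟨fun _ h _ h' => h.union h', fun _ h _ h' => h.isCoset_inter h'⟩ .empty (.of isCoset_univ)
    (fun X hX Z hZ => ?_) (fun X hX Y hY => h_union X Y hX hY) X hX
  induction hX using FiniteUnion.induction with
  | h_empty => simpa using h_empty
  | h_union C W hC _ ih =>
    simpa [Set.union_sdiff_distrib] using h_union _ _ _ _ (h_sdiff C Z hC hZ) ih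

theorem preimage_mem_cosetAlgebra {X : Set M} (hX : X ∈ cosetAlgebra M) (f : N →+ M) (b : M) :
    (fun y => f y + b) ⁻¹' X ∈ cosetAlgebra N := by
  refine BooleanSubalgebra.closure_bot_sup_induction
    (p := fun X _ => (fun y => f y + b) ⁻¹' X ∈ cosetAlgebra N)
    (fun X hX => mem_cosetAlgebra (hX.isCoset_preimage f b)) BooleanSubalgebra.bot_mem
    (fun X _ Y _ h h' => BooleanSubalgebra.sup_mem h h')
    (fun X _ h => BooleanSubalgebra.compl_mem h) hX

/-- A finite union `Z` of cosets in `M × ℤ` agrees, up to finite sets in the fibres over `M`, with a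
finite union of cosets that is periodic in the last coordinate. -/
theorem exists_periodic_part {Z : Set (M × ℤ)} (hZ : FiniteUnion IsCoset Z) :
    ∃ W ⊆ Z, FiniteUnion IsCoset W ∧ (∀ y, {t | (y, t) ∈ Z \ W}.Finite) ∧
      ∃ m : ℤ, m ≠ 0 ∧ ∀ y t k, (y, t) ∈ W → (y, t + m * k) ∈ W := by
  induction hZ using FiniteUnion.induction with
  | h_empty => exact ⟨∅, subset_rfl, .empty, by simp, 1, by simp⟩
  | h_union C Z hC _ ih =>
    obtain ⟨W, hWZ, hW, hfin, m, hm, hper⟩ := ih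
    obtain ⟨c, G, rfl⟩ := id hC
    -- If `G` contains a nonzero vertical vector, `C` is periodic and is kept in `W`; otherwise each
    -- fibre of `C` has at most one point and `C` is dropped.
    by_cases hG : ∃ l : ℤ, l ≠ 0 ∧ ((0, l) : M × ℤ) ∈ G
    · obtain ⟨l, hl, hlG⟩ := hG
      refine ⟨_, Set.union_subset_union_right _ hWZ, (FiniteUnion.of hC).union hW,
        fun y => (hfin y).subset ?_, m * l, mul_ne_zero hm hl, ?_⟩
      · rintro t ⟨h | h, h'⟩
        · exact absurd (Or.inl h) h'
        · exact ⟨h, fun h'' => h' (Or.inr h'')⟩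
      · rintro y t k (h | h)
        · left
          have : ((y, t + m * l * k) : M × ℤ) - c = ((y, t) - c) + (m * k) • (0, l) := by
            ext
            · simp
            · simp; ring
          simp only [Set.mem_ofPred_eq]
          rw [this]
          exact G.add_mem h (G.zsmul_mem hlG _)
        · right
          rw [mul_assoc]
          exact hper y t _ h
    · refine ⟨W, hWZ.trans Set.subset_union_right, hW, fun y => ?_, m, hm, hper⟩
      refine ((Set.Subsingleton.finite (s := {t | (y, t) - c ∈ G}) ?_).union (hfin y)).subset ?_
      · intro t ht s hs
        by_contra hne
        refine hG ⟨t - s, sub_ne_zero.2 hne, ?_⟩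
        have : ((0, t - s) : M × ℤ) = ((y, t) - c) - ((y, s) - c) := by ext <;> simp
        rw [this]
        exact G.sub_mem ht hs
      · rintro t ⟨h | h, h'⟩
        · exact Or.inl h
        · exact Or.inr ⟨h, h'⟩

/-- This eliminates one existential quantifier. If `C` has a vertical period, `Z` may be replaced by
its periodic part, and a periodic set projects onto the union of finitely many of its slices. If
not, projection is injective on `C` and commutes with the difference. -/
theorem image_fst_mem_cosetAlgebra {X : Set (M × ℤ)} (hX : X ∈ cosetAlgebra (M × ℤ)) :
    Prod.fst '' X ∈ cosetAlgebra M := by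
  induction hX using cosetAlgebra_induction with
  | h_empty => simpa using (cosetAlgebra M).bot_mem
  | h_union X Y _ _ hX hY =>
    rw [Set.image_union]
    exact BooleanSubalgebra.sup_mem hX hY
  | h_sdiff C Z hC hZ =>
    obtain ⟨c, G, hCG⟩ := id hC
    by_cases hG : ∃ l : ℤ, l ≠ 0 ∧ ((0, l) : M × ℤ) ∈ G
    · obtain ⟨l, hl, hlG⟩ := hG
      obtain ⟨W, hWZ, hW, hfin, m, hm, hper⟩ := exists_periodic_part hZ
      have hml : m * l ≠ 0 := mul_ne_zero hm hl
      have key : ∀ y t k, (y, t) ∈ C \ W → (y, t + m * l * k) ∈ C \ W := by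
        rintro y t k ⟨hC', hW'⟩
        refine ⟨?_, fun h => hW' ?_⟩
        · have : ((y, t + m * l * k) : M × ℤ) - c = ((y, t) - c) + (m * k) • (0, l) := by
            ext
            · simp
            · simp; ring
          rw [hCG, Set.mem_ofPred_eq] at hC' ⊢
          rw [this]
          exact G.add_mem hC' (G.zsmul_mem hlG _)
        · convert hper y _ (-(l * k)) h using 2
          ring
      have : Prod.fst '' (C \ Z) = (Finset.Ico 0 |m * l|).sup
          fun r => (fun y : M => AddMonoidHom.inl M ℤ y + (0, r)) ⁻¹' (C \ W) := by
        rw [Finset.sup_set_eq_biUnion]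
        ext y
        simp only [Set.mem_image, Prod.exists, exists_and_right, exists_eq_right, Set.mem_iUnion,
          Set.mem_preimage, AddMonoidHom.inl_apply, Prod.mk_add_mk, add_zero, zero_add,
          Finset.mem_Ico, exists_prop]
        constructor
        · rintro ⟨t, hC', hZ'⟩
          refine ⟨t % (m * l), ⟨Int.emod_nonneg _ hml, Int.emod_lt_abs _ hml⟩, ?_⟩
          convert key y t (-(t / (m * l))) ⟨hC', fun h => hZ' (hWZ h)⟩ using 2
          rw [Int.emod_def]; ring
        -- One point of `C \ W` gives infinitely many in its fibre, and only finitely many of them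
        -- can lie in `Z`.
        · rintro ⟨r, -, hr⟩
          have hinf : (Set.range fun k : ℤ => r + m * l * k).Infinite :=
            Set.infinite_range_of_injective fun a b h => by simpa [hm, hl] using h
          obtain ⟨-, ⟨k, rfl⟩, hk⟩ := hinf.exists_notMem_finite (hfin y)
          have h := key y r k hr
          exact ⟨_, h.1, fun h' => hk ⟨h', h.2⟩⟩
      rw [this]
      refine Finset.sup_mem (cosetAlgebra M : Set (Set M)) BooleanSubalgebra.bot_mem
        (fun _ h _ h' => BooleanSubalgebra.sup_mem h h') _ _ fun r _ => ?_
      exact preimage_mem_cosetAlgebra (BooleanSubalgebra.sdiff_mem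
        (mem_cosetAlgebra (.of hC)) (mem_cosetAlgebra hW)) _ _
    · have hinj : Set.InjOn Prod.fst C := by
        rw [hCG]
        rintro ⟨y, t⟩ ht ⟨z, s⟩ hs (rfl : y = z)
        by_contra hne
        refine hG ⟨t - s, sub_ne_zero.2 fun h => hne (by rw [h]), ?_⟩
        have : ((0, t - s) : M × ℤ) = ((y, t) - c) - ((y, s) - c) := by ext <;> simp
        rw [this]
        exact G.sub_mem ht hs
      rw [hinj.image_sdiff]
      exact BooleanSubalgebra.sdiff_mem
        (mem_cosetAlgebra ((FiniteUnion.of hC).isCoset_image (AddMonoidHom.fst M ℤ)))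
        (mem_cosetAlgebra (((FiniteUnion.of hC).isCoset_inter hZ).isCoset_image
          (AddMonoidHom.fst M ℤ)))

end Cosets

end QuasiCoset

namespace QuasiCoset

/-! ### Quantifier elimination, and definability of cosets -/

section Definable

theorem exists_addMonoidHom_realize {α : Type*} (t : addLang.Term α) :
    ∃ f : (α → ℤ) →+ ℤ, ∀ v, t.realize v = f v := by
  induction t with
  | var a => exact ⟨Pi.evalAddMonoidHom _ a, fun v => rfl⟩
  | func f ts ih =>
    cases f with
    | zero => exact ⟨0, fun v => rfl⟩
    | add =>
      choose g hg using ih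
      refine ⟨g 0 + g 1, fun v => ?_⟩
      rw [AddMonoidHom.add_apply, ← hg, ← hg]
      rfl

/-- Extension of a tuple by one more bound variable, as a homomorphism. -/
def snocHom (α : Type*) (n : ℕ) : (α ⊕ Fin n → ℤ) × ℤ →+ (α ⊕ Fin (n + 1) → ℤ) where
  toFun v := Sum.elim (v.1 ∘ Sum.inl) (Fin.snoc (v.1 ∘ Sum.inr) v.2)
  map_zero' := by
    ext (a | i)
    · rfl
    · refine Fin.lastCases ?_ (fun i => ?_) i <;> simp
  map_add' v w := by
    ext (a | i)
    · rfl
    · refine Fin.lastCases ?_ (fun i => ?_) i <;> simp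

theorem setOf_realize_mem_cosetAlgebra {α : Type*} {n : ℕ} (φ : addLang.BoundedFormula α n) :
    {v : α ⊕ Fin n → ℤ | φ.Realize (v ∘ Sum.inl) (v ∘ Sum.inr)} ∈ cosetAlgebra (α ⊕ Fin n → ℤ) := by
  induction φ with
  | falsum => exact BooleanSubalgebra.bot_mem
  | equal t s =>
    obtain ⟨f, hf⟩ := exists_addMonoidHom_realize t
    obtain ⟨g, hg⟩ := exists_addMonoidHom_realize s
    refine mem_cosetAlgebra (.of ⟨0, (f - g).ker, ?_⟩)
    ext v
    have : (Language.BoundedFormula.equal t s).Realize (v ∘ Sum.inl) (v ∘ Sum.inr) ↔ f v = g v := by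
      rw [← hf, ← hg]
      simp [Language.BoundedFormula.Realize, Sum.elim_comp_inl_inr]
    simp [this, AddMonoidHom.mem_ker, sub_eq_zero]
  | rel R => exact R.elim
  | imp φ ψ hφ hψ =>
    convert BooleanSubalgebra.himp_mem hφ hψ using 1
    ext v
    simp [himp_eq, Language.BoundedFormula.Realize, imp_iff_or_not]
  | @all n φ ih =>
    -- A universal quantifier is the complement of the projection of the complement.
    have h := BooleanSubalgebra.compl_mem (image_fst_mem_cosetAlgebra
      (preimage_mem_cosetAlgebra (BooleanSubalgebra.compl_mem ih) (snocHom α n) 0))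
    convert h using 1
    ext v
    simp [Language.BoundedFormula.Realize, snocHom]

theorem IsDefinable.mem_cosetAlgebra {n : ℕ} {A : Set (Fin n → ℤ)} (hA : IsDefinable A) :
    A ∈ cosetAlgebra (Fin n → ℤ) := by
  obtain ⟨φ, rfl⟩ := Set.definable_iff_exists_formula_sum.1 hA
  let f : (Fin n → ℤ) →+ ((Set.univ : Set ℤ) ⊕ Fin n) ⊕ Fin 0 → ℤ :=
    { toFun := fun v => Sum.elim (Sum.elim 0 v) 0
      map_zero' := by ext ((a | i) | i) <;> rfl
      map_add' := fun v w => by ext ((a | i) | i) <;> first | exact i.elim0 | simp }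
  -- The parameters are substituted through the translation part of an affine map.
  convert preimage_mem_cosetAlgebra (setOf_realize_mem_cosetAlgebra φ) f
    (Sum.elim (Sum.elim (↑) 0) 0) using 1
  ext v
  simp only [Set.mem_ofPred_eq, Set.mem_preimage]
  rw [Language.Formula.Realize]
  refine iff_of_eq (congrArg₂ _ ?_ (Subsingleton.elim _ _))
  ext (a | i) <;> simp [f]

variable {α : Type*}

theorem definableFun_add {f g : (α → ℤ) → ℤ} (hf : Set.univ.DefinableFun addLang f)
    (hg : Set.univ.DefinableFun addLang g) : Set.univ.DefinableFun addLang fun v => f v + g v := by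
  have h : Set.univ.DefinableFun addLang fun v : Fin 2 → ℤ => v 0 + v 1 :=
    .of_empty (.fun_symbol (L := addLang) AddFunc.add)
  refine Set.DefinableFun.comp (g := fun v => ![f v, g v]) ?_ h
  intro i
  fin_cases i
  exacts [hf, hg]

theorem definableFun_const (a : ℤ) : Set.univ.DefinableFun addLang fun _ : α → ℤ => a :=
  addLang.definableFun_const α (Set.mem_univ a)

theorem definableFun_neg {f : (α → ℤ) → ℤ} (hf : Set.univ.DefinableFun addLang f) :
    Set.univ.DefinableFun addLang fun v => -f v := by
  have h : Set.univ.DefinableFun addLang fun v : Fin 1 → ℤ => -v 0 := by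
    have h' := (definableFun_add (.proj addLang (i := none)) (.proj addLang (i := some 0))).ofPred_eq
      (definableFun_const (α := Option (Fin 1)) 0)
    rw [Set.DefinableFun]
    convert h' using 1
    ext v
    simp [Function.tupleGraph]
    omega
  exact Set.DefinableFun.comp (g := fun v => ![f v]) (fun i => by fin_cases i; exact hf) h

variable (α) in
/-- The additive group of definable functions. -/
def definableFunctions : AddSubgroup ((α → ℤ) → ℤ) where
  carrier := {f | Set.univ.DefinableFun addLang f}
  zero_mem' := definableFun_const 0
  add_mem' hf hg := definableFun_add hf hg
  neg_mem' hf := definableFun_neg hf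

/-- `G` is finitely generated, so membership says that a system of integer linear equations in the
coefficients is solvable. -/
theorem isDefinable_coset {n : ℕ} (c : Fin n → ℤ) (G : AddSubgroup (Fin n → ℤ)) :
    IsDefinable {x | x - c ∈ G} := by
  obtain ⟨m, g, hg⟩ := Submodule.fg_iff_exists_fin_generating_family.1
    (IsNoetherian.noetherian (AddSubgroup.toIntSubmodule G))
  have hlin : ∀ i, (fun w : Fin n ⊕ Fin m → ℤ => c i + ∑ j, g j i * w (Sum.inr j)) ∈
      definableFunctions (Fin n ⊕ Fin m) := fun i => by
    refine add_mem (definableFun_const (c i)) ?_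
    have : (fun w : Fin n ⊕ Fin m → ℤ => ∑ j, g j i * w (Sum.inr j)) =
        ∑ j, g j i • fun w : Fin n ⊕ Fin m → ℤ => w (Sum.inr j) := by
      ext w
      simp
    rw [this]
    exact sum_mem fun j _ => zsmul_mem (Set.DefinableFun.proj addLang) _
  have h : (Set.univ : Set ℤ).Definable addLang
      (⋂ i, {w : Fin n ⊕ Fin m → ℤ | w (Sum.inl i) = c i + ∑ j, g j i * w (Sum.inr j)}) :=
    Set.definable_iInter_of_finite fun i =>
      (Set.DefinableFun.proj addLang (i := Sum.inl i)).ofPred_eq (hlin i)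
  rw [IsDefinable]
  convert h.exists_of_finite using 1
  ext x
  have : x - c ∈ G ↔ x - c ∈ Submodule.span ℤ (Set.range g) := by rw [hg]; rfl
  simp only [Set.mem_ofPred_eq, this, Submodule.mem_span_range_iff_exists_fun, Set.mem_iInter,
    Sum.elim_inl, Sum.elim_inr, funext_iff]
  refine exists_congr fun u => forall_congr' fun i => ?_
  simp only [Finset.sum_apply, Pi.smul_apply, smul_eq_mul, Pi.sub_apply, mul_comm (u _)]
  omega

end Definable

/-! ### Rank, and removal of cosets from quasi-cosets -/

section Rank

variable {n : ℕ}

theorem isCosetOfRank_iff {k : ℕ} {C : Set (Fin n → ℤ)} : IsCosetOfRank k C ↔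
    ∃ (c : Fin n → ℤ) (G : AddSubgroup (Fin n → ℤ)),
      Module.finrank ℤ G = k ∧ C = {x | x - c ∈ G} := by
  refine exists₂_congr fun c G => and_congr_right fun _ => ?_
  have : (fun g => c + g) '' (G : Set (Fin n → ℤ)) = {x | x - c ∈ G} := by
    ext x
    constructor
    · rintro ⟨g, hg, rfl⟩
      simpa using hg
    · exact fun hx => ⟨x - c, hx, by simp⟩
  rw [this]

theorem IsCosetOfRank.isDefinable {k : ℕ} {C : Set (Fin n → ℤ)} (hC : IsCosetOfRank k C) :
    IsDefinable C := by
  obtain ⟨c, G, -, rfl⟩ := isCosetOfRank_iff.1 hC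
  exact isDefinable_coset c G

theorem finrank_addSubgroup_le (G : AddSubgroup (Fin n → ℤ)) : Module.finrank ℤ G ≤ n :=
  (AddSubgroup.toIntSubmodule G).finrank_le.trans_eq (Module.finrank_fin_fun ℤ)

theorem finrank_addSubgroup_mono {G H : AddSubgroup (Fin n → ℤ)} (h : G ≤ H) :
    Module.finrank ℤ G ≤ Module.finrank ℤ H :=
  Submodule.finrank_mono (s := AddSubgroup.toIntSubmodule G) (t := AddSubgroup.toIntSubmodule H) h

theorem finite_quotient_of_finrank_eq {G H : AddSubgroup (Fin n → ℤ)} (h : H ≤ G)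
    (hr : Module.finrank ℤ H = Module.finrank ℤ G) : Finite (G ⧸ H.addSubgroupOf G) := by
  have : Module.Free ℤ G :=
    inferInstanceAs (Module.Free ℤ (AddSubgroup.toIntSubmodule G))
  have : Module.Finite ℤ G :=
    inferInstanceAs (Module.Finite ℤ (AddSubgroup.toIntSubmodule G))
  refine Submodule.finiteQuotientOfFreeOfRankEq
    (AddSubgroup.toIntSubmodule (H.addSubgroupOf G)) ?_
  rw [← hr]
  exact (AddSubgroup.addSubgroupOfEquivOfLe h).toIntLinearEquiv.finrank_eq

theorem CoveredInRank.mono {j k : ℕ} {X Y : Set (Fin n → ℤ)} (hX : CoveredInRank j X)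
    (hjk : j ≤ k) (hYX : Y ⊆ X) : CoveredInRank k Y := by
  obtain ⟨F, hF, hFC, hXF⟩ := hX
  refine ⟨F, hF, fun C hC => ?_, hYX.trans hXF⟩
  obtain ⟨i, hi, hiC⟩ := hFC C hC
  exact ⟨i, hi.trans hjk, hiC⟩

theorem CoveredInRank.union {k : ℕ} {X Y : Set (Fin n → ℤ)} (hX : CoveredInRank k X)
    (hY : CoveredInRank k Y) : CoveredInRank k (X ∪ Y) := by
  obtain ⟨F, hF, hFC, hXF⟩ := hX
  obtain ⟨F', hF', hFC', hYF'⟩ := hY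
  refine ⟨F ∪ F', hF.union hF', ?_, ?_⟩
  · rintro C (h | h)
    exacts [hFC C h, hFC' C h]
  · rw [Set.sUnion_union]
    exact Set.union_subset_union hXF hYF'

theorem rank_lt_iff {k : ℕ} {X : Set (Fin n → ℤ)} :
    rank X < k ↔ X = ∅ ∨ ∃ j < k, CoveredInRank j X := by
  unfold rank
  split_ifs with h
  · simp [h]; omega
  · simp only [Nat.cast_lt, h, false_or]
    -- Nonemptiness ensures that `sInf` is attained rather than a default `0`.
    have hne : {k : ℕ | CoveredInRank k X}.Nonempty := ⟨n, coveredInRank_self X⟩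
    exact ⟨fun h' => ⟨_, h', Nat.sInf_mem hne⟩,
      fun ⟨j, hj, hX⟩ => (Nat.sInf_le hX).trans_lt hj⟩

theorem rank_lt_mono {k : ℕ} {X Y : Set (Fin n → ℤ)} (hX : rank X < k) (hYX : Y ⊆ X) :
    rank Y < k := by
  rw [rank_lt_iff] at hX ⊢
  rcases hX with rfl | ⟨j, hj, hX⟩
  · exact Or.inl (Set.subset_empty_iff.1 hYX)
  · exact Or.inr ⟨j, hj, hX.mono le_rfl hYX⟩

theorem rank_union_lt {k : ℕ} {X Y : Set (Fin n → ℤ)} (hX : rank X < k) (hY : rank Y < k) :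
    rank (X ∪ Y) < k := by
  rw [rank_lt_iff] at hX hY
  rcases hX with rfl | ⟨i, hi, hX'⟩
  · simpa using rank_lt_iff.2 hY
  rcases hY with rfl | ⟨j, hj, hY'⟩
  · simpa using rank_lt_iff.2 (Or.inr ⟨i, hi, hX'⟩)
  · exact rank_lt_iff.2 (Or.inr ⟨max i j, max_lt hi hj,
      (hX'.mono (le_max_left i j) subset_rfl).union (hY'.mono (le_max_right i j) subset_rfl)⟩)

theorem IsCosetOfRank.rank_lt {j k : ℕ} {C : Set (Fin n → ℤ)} (hC : IsCosetOfRank j C)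
    (hjk : j < k) : rank C < k :=
  rank_lt_iff.2 (Or.inr ⟨j, hjk, {C}, Set.finite_singleton C, by
    rintro _ rfl
    exact ⟨j, le_rfl, hC⟩, by simp⟩)

/-- The complement, in a coset, of a coset of a subgroup of the same rank. -/
theorem coset_sdiff_eq_sUnion {c d : Fin n → ℤ} {G H : AddSubgroup (Fin n → ℤ)} (h : H ≤ G)
    (hr : Module.finrank ℤ H = Module.finrank ℤ G) :
    ∃ F : Set (Set (Fin n → ℤ)), F.Finite ∧
      (∀ D ∈ F, IsCosetOfRank (Module.finrank ℤ G) D ∧ D ⊆ {x | x - c ∈ G}) ∧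
      {x | x - c ∈ G} \ {x | x - d ∈ H} = ⋃₀ F := by
  have := finite_quotient_of_finrank_eq h hr
  -- These are the cosets of `H` inside `c + G` other than `d + H`; there are finitely many since
  -- `H` has finite index in `G`.
  refine ⟨{D | d ∉ D ∧ ∃ g ∈ G, D = {x | x - (c + g) ∈ H}}, ?_, ?_, ?_⟩
  · refine (Set.finite_range
      fun q : G ⧸ H.addSubgroupOf G => {x | x - (c + q.out) ∈ H}).subset ?_
    rintro _ ⟨-, g, hg, rfl⟩
    refine ⟨QuotientAddGroup.mk ⟨g, hg⟩, setOf_sub_mem_eq ?_⟩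
    have := QuotientAddGroup.mk_out_eq_add (H.addSubgroupOf G) ⟨g, hg⟩
    obtain ⟨z, hz⟩ := this
    rw [hz]
    have : -(z : G).1 ∈ H := H.neg_mem z.2
    convert this using 1
    simp
  · rintro _ ⟨-, g, hg, rfl⟩
    refine ⟨isCosetOfRank_iff.2 ⟨_, H, hr, rfl⟩, fun x hx => ?_⟩
    have : x - c = (x - (c + g)) + g := by abel
    rw [Set.mem_ofPred_eq, this]
    exact G.add_mem (h hx) hg
  · ext x
    constructor
    · rintro ⟨hx, hxd⟩
      refine ⟨{y | y - x ∈ H}, ⟨fun hd => hxd ?_, x - c, hx, by simp⟩, by simp⟩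
      rw [Set.mem_ofPred_eq, ← neg_sub]
      exact H.neg_mem hd
    · rintro ⟨_, ⟨hd, g, hg, rfl⟩, hx⟩
      constructor
      · have : x - c = (x - (c + g)) + g := by abel
        rw [Set.mem_ofPred_eq, this]
        exact G.add_mem (h hx) hg
      · intro hxd
        apply hd
        have : d - (c + g) = (x - (c + g)) - (x - d) := by abel
        rw [Set.mem_ofPred_eq, this]
        exact H.sub_mem hx hxd

theorem IsCoset.finiteUnion_isQuasiCoset {C : Set (Fin n → ℤ)} (hC : IsCoset C) :
    FiniteUnion IsQuasiCoset C := by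
  obtain ⟨c, G, rfl⟩ := hC
  exact .of ⟨_, finrank_addSubgroup_le G, _, ∅, isCosetOfRank_iff.2 ⟨c, G, rfl, rfl⟩,
    Set.empty_subset _, Set.definable_empty, rank_lt_iff.2 (Or.inl rfl), by simp⟩

theorem IsQuasiCoset.sdiff_coset {X D : Set (Fin n → ℤ)} (hX : IsQuasiCoset X) (hD : IsCoset D) :
    FiniteUnion IsQuasiCoset (X \ D) := by
  obtain ⟨k, hk, C, Z, hC, hZC, hZ, hZk, rfl⟩ := hX
  obtain ⟨c, G, rfl, rfl⟩ := isCosetOfRank_iff.1 hC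
  obtain ⟨d, H, rfl⟩ := hD
  by_cases hne : ∃ e, e - c ∈ G ∧ e - d ∈ H
  · obtain ⟨e, hec, hed⟩ := hne
    rw [setOf_sub_mem_eq hec] at hC hZC ⊢
    rw [setOf_sub_mem_eq hed]
    have hGH : {x | x - e ∈ G} ∩ {x | x - e ∈ H} = {x | x - e ∈ G ⊓ H} := rfl
    -- Smaller rank: the intersection is absorbed into `Z`. Equal rank: the rest of `C` is a finite
    -- union of cosets of the same rank, each losing its share of `Z`.
    rcases (finrank_addSubgroup_mono (inf_le_left : G ⊓ H ≤ G)).lt_or_eq with hlt | heq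
    · have hI : IsCosetOfRank _ {x | x - e ∈ G ⊓ H} := isCosetOfRank_iff.2 ⟨e, _, rfl, rfl⟩
      refine .of ⟨_, hk, _, Z ∪ {x | x - e ∈ G ⊓ H}, hC,
        Set.union_subset hZC fun x hx => hx.1, hZ.union hI.isDefinable,
        rank_union_lt hZk (hI.rank_lt hlt), ?_⟩
      rw [← hGH, ← Set.sdiff_sdiff]
      ext x
      simp +contextual
    · obtain ⟨F, hF, hFC, hsd⟩ := coset_sdiff_eq_sUnion (c := e) (d := e) inf_le_left heq
      have : ({x | x - e ∈ G} \ Z) \ {x | x - e ∈ H} = ⋃₀ ((fun D => D \ Z) '' F) := by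
        rw [Set.sdiff_sdiff_comm, ← Set.sdiff_self_inter (s := {x | x - e ∈ G}), hGH, hsd,
          Set.sUnion_image, Set.sUnion_eq_biUnion]
        simp only [Set.iUnion_sdiff]
      rw [this]
      refine .sUnion (hF.image _) ?_
      rintro _ ⟨D, hD, rfl⟩
      refine .of ⟨_, hk, D, D ∩ Z, (hFC D hD).1, Set.inter_subset_left,
        (hFC D hD).1.isDefinable.inter hZ, rank_lt_mono hZk Set.inter_subset_right, ?_⟩
      simp
  · refine .of ⟨_, hk, _, Z, hC, hZC, hZ, hZk, sdiff_eq_left.2 ?_⟩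
    exact Set.disjoint_left.2 fun x hx hx' => hne ⟨x, hx.1, hx'⟩

theorem FiniteUnion.isQuasiCoset_sdiff {X Z : Set (Fin n → ℤ)} (hX : FiniteUnion IsQuasiCoset X)
    (hZ : FiniteUnion IsCoset Z) : FiniteUnion IsQuasiCoset (X \ Z) := by
  induction hZ using FiniteUnion.induction generalizing X with
  | h_empty => simpa using hX
  | h_union C Z hC _ ih =>
    rw [← Set.sdiff_sdiff]
    refine ih ?_
    induction hX using FiniteUnion.induction with
    | h_empty => simpa using .empty
    | h_union Y W hY _ ih' =>
      rw [Set.union_sdiff_distrib]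
      exact (hY.sdiff_coset hC).union ih'

theorem IsDefinable.finiteUnion_isQuasiCoset {A : Set (Fin n → ℤ)} (hA : IsDefinable A) :
    FiniteUnion IsQuasiCoset A := by
  have h := hA.mem_cosetAlgebra
  clear hA
  induction h using cosetAlgebra_induction with
  | h_empty => exact .empty
  | h_union X Y _ _ hX hY => exact hX.union hY
  | h_sdiff C Z hC hZ => exact hC.finiteUnion_isQuasiCoset.isQuasiCoset_sdiff hZ

end Rank

end QuasiCoset

theorem theorem4p7 (n : ℕ) (hn : 0 < n) (A : Set (Fin n → ℤ)) (hne : A.Nonempty)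
    (hA : QuasiCoset.IsDefinable A) :
    ∃ F : Set (Set (Fin n → ℤ)), F.Finite ∧ (∀ X ∈ F, QuasiCoset.IsQuasiCoset X) ∧ A = ⋃₀ F :=
  hA.finiteUnion_isQuasiCoset
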